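/- Let $X$ be a real Hilbert space and let $\Omega_1,\Omega_2,\Omega_3\subset X$ be nonempty, closed, pairwise disjoint (possibly nonconvex) sets. Write $d(x;\Omega)=\inf_{\omega\in\Omega}\|x-\omega\|$ and $\Pi(x;\Omega)=\{\omega\in\Omega : \|x-\omega\|=d(x;\Omega)\}$. For $\varepsilon\ge 0$ and $x\in\Omega$ let $$\widehat N_\varepsilon(x;\Omega)=\Big\{v\in X : \limsup_{y\to x,\ y\in\Omega}\frac{\langle v,y-x\rangle}{\|y-x\|}\le\varepsilon\Big\},$$ let $\widehat N_\varepsilon(x;\Omega)=\emptyset$ for $x\notin\Omega$, and let the basic (limiting, Mordukhovich) normal cone $N(\bar x;\Omega)$ be the set of all $v\in X$ for which there are sequences $x_k\to\bar x$, $\varepsilon_k\to 0$ with $\varepsilon_k\ge 0$, and $v_k\in\widehat N_{\varepsilon_k}(x_k;\Omega)$ with $v_k\to v$ weakly. The function $d(\cdot;\Omega)$ is called well posed at $\bar x\notin\Omega$ if for every sequence $x_k\to\bar x$ with $d(x_k;\Omega)\to d(\bar x;\Omega)$ there is a sequence of points $w_k\in\Pi(x_k;\Omega)$ that contains a convergent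 subsequence. Let $\bar x\in X$ be a local minimizer of $D(x)=\sum_{i=1}^3 d(x;\Omega_i)$ over $X$, and suppose that for each $i$ with $\bar x\notin\Omega_i$ the function $d(\cdot;\Omega_i)$ is well posed at $\bar x$. Put $$A_i=\frac{\bar x-\Pi(\bar x;\Omega_i)}{d(\bar x;\Omega_i)}\ \text{ if }\bar x\notin\Omega_i,\qquad A_i=N(\bar x;\Omega_i)\cap\{v\in X:\|v\|\le 1\}\ \text{ if }\bar x\in\Omega_i .$$ Then one of the following two alternatives holds. (i) The point $\bar x$ belongs to exactly one of the sets, say (after renumbering) $\bar x\in\Omega_1$ and $\bar x\notin\Omega_2\cup\Omega_3$, and there are $a_2\in A_2$ and $a_3\in A_3$ with $\langle a_2,a_3\rangle\le-\tfrac12$ and $-a_2-a_3\in N(\bar x;\Omega_1)$. (ii) The point $\bar x$ belongs to none of the sets $\Omega_1,\Omega_2,\Omega_3$, and there are $a_i\in A_i$, $i=1,2,3$, with $\langle a_i,a_j\rangle=-\tfrac12$ for all $i\ne j$. -/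

import Mathlib

namespace FermatTorricelli

open Filter Topology

variable {X : Type*} [NormedAddCommGroup X] [InnerProductSpace ℝ X]

/-- The metric projection `Π(x; Ω)`. -/
def proj (x : X) (Ω : Set X) : Set X :=
  {w | w ∈ Ω ∧ ‖x - w‖ = Metric.infDist x Ω}

/-- Well-posedness of the distance function `d(·; Ω)` at `x`: for every sequence `u k → x` with
`d(u k; Ω) → d(x; Ω)` there is a sequence of projections `w k ∈ Π(u k; Ω)` that contains a
convergent subsequence. -/
def WellPosedAt (Ω : Set X) (x : X) : Prop :=
  ∀ u : ℕ → X, Tendsto u atTop (𝓝 x) →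
    Tendsto (fun k => Metric.infDist (u k) Ω) atTop (𝓝 (Metric.infDist x Ω)) →
    ∃ w : ℕ → X, (∀ k, w k ∈ proj (u k) Ω) ∧
      ∃ (φ : ℕ → ℕ) (l : X), StrictMono φ ∧ Tendsto (w ∘ φ) atTop (𝓝 l)

/-- The set of `ε`-normals to `Ω` at `x` (empty if `x ∉ Ω`), with the dual of the Hilbert space
identified with the space itself. The condition says that the upper limit of
`⟪v, y - x⟫ / ‖y - x‖` as `y → x`, `y ∈ Ω`, is at most `ε`. -/
def epsNormals (ε : ℝ) (x : X) (Ω : Set X) : Set X :=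
  {v | x ∈ Ω ∧ ∀ η > ε, ∀ᶠ y in 𝓝[Ω] x, inner ℝ v (y - x) ≤ η * ‖y - x‖}

/-- The basic (limiting, Mordukhovich) normal cone `N(x; Ω)`: the sequential outer limit of the
sets of `ε`-normals at `u` as `u → x` and `ε ↓ 0`, where the normals converge weakly. -/
def normalCone (x : X) (Ω : Set X) : Set X :=
  {v | ∃ (u : ℕ → X) (ε : ℕ → ℝ) (n : ℕ → X),
    Tendsto u atTop (𝓝 x) ∧ (∀ k, 0 ≤ ε k) ∧ Tendsto ε atTop (𝓝 0) ∧
    (∀ z : X, Tendsto (fun k => inner ℝ (n k) z) atTop (𝓝 (inner ℝ v z))) ∧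
    ∀ k, n k ∈ epsNormals (ε k) (u k) Ω}

open Classical in
/-- The set `A(x)` attached to `Ω`: it is `(x - Π(x; Ω)) / d(x; Ω)` if `x ∉ Ω`, and the part of
the basic normal cone in the closed unit ball if `x ∈ Ω`. -/
noncomputable def setA (Ω : Set X) (x : X) : Set X :=
  if x ∈ Ω then normalCone x Ω ∩ Metric.closedBall 0 1
  else (fun w => (Metric.infDist x Ω)⁻¹ • (x - w)) '' proj x Ω

end FermatTorricelli

namespace FermatTorricelli

open Filter Topology

variable {X : Type*} [NormedAddCommGroup X] [InnerProductSpace ℝ X]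

/-! If `x ∉ Ω`, comparing with the distance to one fixed projection of `x` bounds `d(·; Ω)` above by
a quadratic that touches it at `x` and has slope a unit vector of `setA Ω x`. Putting these bounds
into `D` keeps `x` a local minimizer, so smooth first-order conditions apply and any choice of
slopes works. Well-posedness supplies the projections. If `x` lies in no set, the three unit slopes
sum to zero. If `x ∈ Ω i`, the other two slopes satisfy `‖a + b‖ ≤ 1`, as `d(·; Ω i)` is at most `‖·
- x‖`, and `-a - b` is a Fréchet normal, as `d(·; Ω i)` vanishes on `Ω i`. -/

/-- A well-posed distance function has a nonempty set `A(x)`. -/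
lemma WellPosedAt.setA_nonempty {Ω : Set X} {x : X} (h : WellPosedAt Ω x) (hx : x ∉ Ω) :
    (setA Ω x).Nonempty := by
  obtain ⟨w, hw, -⟩ := h (fun _ => x) tendsto_const_nhds tendsto_const_nhds
  rw [setA, if_neg hx]
  exact ⟨_, w 0, hw 0, rfl⟩

lemma norm_eq_one_of_mem_setA {Ω : Set X} (hc : IsClosed Ω) (hne : Ω.Nonempty) {x a : X}
    (hx : x ∉ Ω) (ha : a ∈ setA Ω x) : ‖a‖ = 1 := by
  rw [setA, if_neg hx] at ha
  obtain ⟨w, ⟨-, hw⟩, rfl⟩ := ha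
  have hd := (hc.notMem_iff_infDist_pos hne).1 hx
  simp only [norm_smul, norm_inv, hw, Real.norm_of_nonneg hd.le]
  exact inv_mul_cancel₀ (ne_of_gt hd)

/-- Outside `Ω` the distance function has a quadratic upper support at `x` with slope any
element of `A(x)`. -/
lemma infDist_le_of_mem_setA {Ω : Set X} (hc : IsClosed Ω) (hne : Ω.Nonempty) {x a : X}
    (hx : x ∉ Ω) (ha : a ∈ setA Ω x) (y : X) :
    Metric.infDist y Ω ≤ Metric.infDist x Ω + inner ℝ a (y - x)
      + (2 * Metric.infDist x Ω)⁻¹ * ‖y - x‖ ^ 2 := by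
  rw [setA, if_neg hx] at ha
  obtain ⟨w, ⟨hwΩ, hw⟩, rfl⟩ := ha
  have hd := (hc.notMem_iff_infDist_pos hne).1 hx
  have hy : Metric.infDist y Ω ≤ ‖y - w‖ := by
    simpa [dist_eq_norm] using Metric.infDist_le_dist_of_mem (x := y) hwΩ
  refine hy.trans ?_
  set d := Metric.infDist x Ω
  have hexp : ‖y - w‖ ^ 2 = d ^ 2 + 2 * inner ℝ (x - w) (y - x) + ‖y - x‖ ^ 2 := by
    rw [← hw, ← norm_add_sq_real]
    congr 2
    abel
  -- The square root is bounded by its tangent at `d ^ 2`, which is exact at `y = x`.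
  have hsq : ‖y - w‖ ≤ (‖y - w‖ ^ 2 + d ^ 2) / (2 * d) := by
    rw [le_div_iff₀ (by positivity)]
    nlinarith [sq_nonneg (‖y - w‖ - d)]
  refine hsq.trans (le_of_eq ?_)
  rw [hexp, real_inner_smul_left]
  field_simp
  ring

/-- First-order necessary condition for a function of the form
`ρ ‖· - x‖ + ⟪v, · - x⟫ + O(‖· - x‖ ^ 2)` to have a local minimum at `x`. -/
lemma norm_le_of_eventually_nonneg {x v : X} {ρ C : ℝ} (hρ : 0 ≤ ρ)
    (h : ∀ᶠ y in 𝓝 x, 0 ≤ ρ * ‖y - x‖ + inner ℝ v (y - x) + C * ‖y - x‖ ^ 2) : ‖v‖ ≤ ρ := by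
  rcases eq_or_ne v 0 with rfl | hv
  · simpa using hρ
  have hv' : 0 < ‖v‖ := norm_pos_iff.2 hv
  -- Test along the steepest descent ray of `⟪v, ·⟫`, divide by `t * ‖v‖` and let `t ↓ 0`.
  have hpath : Tendsto (fun t : ℝ => x - t • v) (𝓝[>] 0) (𝓝 x) := by
    have : Continuous fun t : ℝ => x - t • v := by fun_prop
    simpa using (this.tendsto 0).mono_left nhdsWithin_le_nhds
  have hlim : Tendsto (fun t : ℝ => ρ + C * (t * ‖v‖)) (𝓝[>] 0) (𝓝 ρ) := by
    have : Continuous fun t : ℝ => ρ + C * (t * ‖v‖) := by fun_prop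
    simpa using (this.tendsto 0).mono_left nhdsWithin_le_nhds
  refine ge_of_tendsto hlim ?_
  filter_upwards [hpath.eventually h, self_mem_nhdsWithin] with t ht htpos
  have htpos : 0 < t := htpos
  have hsub : x - t • v - x = -(t • v) := by abel
  rw [hsub, norm_neg, norm_smul, Real.norm_of_nonneg htpos.le, inner_neg_right,
    real_inner_smul_right, real_inner_self_eq_norm_sq] at ht
  have hprod : 0 ≤ (t * ‖v‖) * (ρ + C * (t * ‖v‖) - ‖v‖) := by linarith
  linarith [nonneg_of_mul_nonneg_right hprod (by positivity)]

/-- The negative of a first-order stationary slope on `Ω` is a Fréchet normal. -/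
lemma neg_mem_epsNormals {Ω : Set X} {x v : X} {C : ℝ} (hx : x ∈ Ω)
    (h : ∀ᶠ y in 𝓝[Ω] x, 0 ≤ inner ℝ v (y - x) + C * ‖y - x‖ ^ 2) :
    -v ∈ epsNormals 0 x Ω := by
  refine ⟨hx, fun η hη => ?_⟩
  have hlim : Tendsto (fun y : X => C * ‖y - x‖) (𝓝[Ω] x) (𝓝 0) := by
    have : Continuous fun y : X => C * ‖y - x‖ := by fun_prop
    simpa using (this.tendsto x).mono_left nhdsWithin_le_nhds
  filter_upwards [h, hlim.eventually (gt_mem_nhds hη)] with y hy hyη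
  rw [inner_neg_left]
  nlinarith [mul_le_mul_of_nonneg_right hyη.le (norm_nonneg (y - x))]

lemma epsNormals_zero_subset_normalCone (x : X) (Ω : Set X) :
    epsNormals 0 x Ω ⊆ normalCone x Ω := fun v hv =>
  ⟨fun _ => x, fun _ => 0, fun _ => v, tendsto_const_nhds, fun _ => le_rfl, tendsto_const_nhds,
    fun _ => tendsto_const_nhds, fun _ => hv⟩

/-- Two of three unit vectors with zero sum have inner product `-1 / 2`. -/
lemma inner_eq_neg_half {a b c : X} (ha : ‖a‖ = 1) (hb : ‖b‖ = 1) (hc : ‖c‖ = 1)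
    (h : a + b + c = 0) : inner ℝ a b = -1 / 2 := by
  have hab := norm_add_sq_real a b
  rw [eq_neg_of_add_eq_zero_left h, norm_neg, ha, hb, hc] at hab
  linarith

/-- This replaces the renumbering of the sets when `x` lies in one of them. -/
lemma exists_sum_fin_three (i : Fin 3) : ∃ j k : Fin 3, i ≠ j ∧ i ≠ k ∧ j ≠ k ∧
    ∀ f : Fin 3 → ℝ, ∑ l, f l = f i + f j + f k := by
  fin_cases i
  · exact ⟨1, 2, by decide, by decide, by decide, fun f => Fin.sum_univ_three f⟩
  · exact ⟨0, 2, by decide, by decide, by decide, fun f => by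
      rw [Fin.sum_univ_three]; exact congrArg (· + f 2) (add_comm (f 0) (f 1))⟩
  · exact ⟨0, 1, by decide, by decide, by decide, fun f => by
      rw [Fin.sum_univ_three]; exact (add_comm _ _).trans (add_assoc _ _ _).symm⟩

end FermatTorricelli

open FermatTorricelli Filter Topology

theorem corollary4p4 {X : Type*} [NormedAddCommGroup X] [InnerProductSpace ℝ X] [CompleteSpace X]
    (Ω : Fin 3 → Set X) (hclosed : ∀ i, IsClosed (Ω i)) (hne : ∀ i, (Ω i).Nonempty)
    (hdisj : ∀ i j, i ≠ j → Disjoint (Ω i) (Ω j)) (x : X)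
    (hwp : ∀ i, x ∉ Ω i → FermatTorricelli.WellPosedAt (Ω i) x)
    (hmin : IsLocalMin (fun y => ∑ i, Metric.infDist y (Ω i)) x) :
    (∃ i j k : Fin 3, i ≠ j ∧ i ≠ k ∧ j ≠ k ∧ x ∈ Ω i ∧ x ∉ Ω j ∧ x ∉ Ω k ∧
      ∃ a ∈ FermatTorricelli.setA (Ω j) x, ∃ b ∈ FermatTorricelli.setA (Ω k) x,
        inner ℝ a b ≤ -1 / 2 ∧ -a - b ∈ FermatTorricelli.normalCone x (Ω i)) ∨
    ((∀ i, x ∉ Ω i) ∧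
      ∃ a : Fin 3 → X, (∀ i, a i ∈ FermatTorricelli.setA (Ω i) x) ∧
        ∀ i j, i ≠ j → inner ℝ (a i) (a j) = -1 / 2) := by
  by_cases hx : ∃ i, x ∈ Ω i
  · left
    obtain ⟨i, hi⟩ := hx
    obtain ⟨j, k, hij, hik, hjk, hsum⟩ := exists_sum_fin_three i
    have hj : x ∉ Ω j := Set.disjoint_left.1 (hdisj i j hij) hi
    have hk : x ∉ Ω k := Set.disjoint_left.1 (hdisj i k hik) hi
    obtain ⟨a, ha⟩ := (hwp j hj).setA_nonempty hj
    obtain ⟨b, hb⟩ := (hwp k hk).setA_nonempty hk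
    set C := (2 * Metric.infDist x (Ω j))⁻¹ + (2 * Metric.infDist x (Ω k))⁻¹
    have key : ∀ᶠ y in 𝓝 x,
        0 ≤ Metric.infDist y (Ω i) + inner ℝ (a + b) (y - x) + C * ‖y - x‖ ^ 2 := by
      filter_upwards [hmin] with y hy
      simp only [hsum, Metric.infDist_zero_of_mem hi] at hy
      have h1 := infDist_le_of_mem_setA (hclosed j) (hne j) hj ha y
      have h2 := infDist_le_of_mem_setA (hclosed k) (hne k) hk hb y
      rw [inner_add_left, add_mul]
      linarith
    have hnorm : ‖a + b‖ ≤ 1 := by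
      refine norm_le_of_eventually_nonneg (x := x) (C := C) zero_le_one ?_
      filter_upwards [key] with y hy
      have : Metric.infDist y (Ω i) ≤ ‖y - x‖ := by
        simpa [dist_eq_norm] using Metric.infDist_le_dist_of_mem (x := y) hi
      linarith
    refine ⟨i, j, k, hij, hik, hjk, hi, hj, hk, a, ha, b, hb, ?_, ?_⟩
    -- For unit vectors, `‖a + b‖ ^ 2 = 2 + 2 * ⟪a, b⟫`, so `‖a + b‖ ≤ 1` is the angle bound.
    · have hab := norm_add_sq_real a b
      rw [norm_eq_one_of_mem_setA (hclosed j) (hne j) hj ha,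
        norm_eq_one_of_mem_setA (hclosed k) (hne k) hk hb] at hab
      nlinarith [norm_nonneg (a + b)]
    · rw [← neg_add']
      refine epsNormals_zero_subset_normalCone x _ (neg_mem_epsNormals (C := C) hi ?_)
      filter_upwards [key.filter_mono nhdsWithin_le_nhds, self_mem_nhdsWithin] with y hy hyΩ
      rwa [Metric.infDist_zero_of_mem hyΩ, zero_add] at hy
  · right
    push Not at hx
    choose a ha using fun i => (hwp i (hx i)).setA_nonempty (hx i)
    have hone : ∀ i, ‖a i‖ = 1 := fun i =>
      norm_eq_one_of_mem_setA (hclosed i) (hne i) (hx i) (ha i)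
    -- With no norm term left, the first-order condition applies with `ρ = 0`.
    have hzero : ∑ i, a i = 0 := by
      refine norm_le_zero_iff.1 (norm_le_of_eventually_nonneg (x := x)
        (C := ∑ i, (2 * Metric.infDist x (Ω i))⁻¹) le_rfl ?_)
      filter_upwards [hmin] with y hy
      have hle := Finset.sum_le_sum fun i (_ : i ∈ Finset.univ) =>
        infDist_le_of_mem_setA (hclosed i) (hne i) (hx i) (ha i) y
      rw [Finset.sum_add_distrib, Finset.sum_add_distrib, ← Finset.sum_mul, ← sum_inner] at hle
      linarith
    rw [Fin.sum_univ_three] at hzero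
    have h01 := inner_eq_neg_half (hone 0) (hone 1) (hone 2) hzero
    have h02 := inner_eq_neg_half (hone 0) (hone 2) (hone 1) (by rw [← hzero]; abel)
    have h12 := inner_eq_neg_half (hone 1) (hone 2) (hone 0) (by rw [← hzero]; abel)
    refine ⟨hx, a, ha, fun i j hij => ?_⟩
    fin_cases i <;> fin_cases j <;>
      first
      | exact absurd rfl hij
      | assumption
      | (rw [real_inner_comm]; assumption)
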